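/- Let $(\Omega,\mathcal F,P)$ be a probability space with an $N$-dimensional Wiener process $W$ and its augmented natural filtration, let $D\subset\mathbb R^k$ be compact, and let $\mathcal D$ be the set of progressively measurable $D$-valued processes $\delta=(\delta_t)_{t\ge0}$. For $\delta\in\mathcal D$ and $y\in\mathbb R^N$ let $Y^\delta$ denote the strong solution of $$dY_t=i(Y_t,\delta_t)\,dt+dW_t,\qquad Y_0=y,$$ and write $\mathbb E_{y,0}$ for the expectation when the process starts from $y$ at time $0$. Assume the following. (A1) The functions $f,h:\mathbb R^N\times D\to\mathbb R$, $g:\mathbb R^N\to\mathbb R$ and $i:\mathbb R^N\times D\to\mathbb R^N$ are continuous, and there are $L_1>0$ and $L_2\in\mathbb R\setminus\{0\}$ such that for all $y,\bar y\in\mathbb R^N$, $\delta\in D$ and $\zeta\in\{f,h,i\}$ $$|g(y)-g(\bar y)|\le L_1|y-\bar y|,\quad |\zeta(y,\delta)-\zeta(\bar y,\delta)|\le L_1|y-\bar y|,\quad (y-\bar y)\cdot[i(y,\delta)-i(\bar y,\delta)]\le L_2|y-\bar y|^2 .$$ (A2) There is a deterministic function $\kappa(t,n)$, $t>0$, $n\in\mathbb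 N$, continuous in $t$, such that for all $\delta\in\mathcal D$, $n\in\mathbb N$, $|y|\le n$ and $t>0$ $$\mathbb E_{y,0}\, e^{\int_0^t h(Y^\delta_r,\delta_r)\,dr}\max\{|f(Y^\delta_t,\delta_t)|,1\}\le\kappa(t,n),$$ and $\int_0^\infty\kappa(t,n)\,dt<\infty$, $\int_0^\infty e^{L_2t}\kappa(t,n)\,dt<\infty$ for every $n$. Let $y\in\mathbb R^N$, let $T_n\to+\infty$, and let $\delta^n,\delta\in\mathcal D$ be such that, for every $t\ge0$, $\delta^n_t\to\delta_t$ a.s. and $Y^{\delta^n}_t\to Y^\delta_t$ a.s., where all these processes start from $y$. Then $$\lim_{n\to\infty}\mathbb E_{y,0}\int_0^{T_n}e^{\int_0^s h(Y^{\delta^n}_r,\delta^n_r)\,dr}\,|f(Y^{\delta^n}_s,\delta^n_s)|\,ds=\mathbb E_{y,0}\int_0^{\infty}e^{\int_0^s h(Y^{\delta}_r,\delta_r)\,dr}\,|f(Y^{\delta}_s,\delta_s)|\,ds,$$ and the same holds with $f$ in place of $|f|$. All the integrands are integrable with respect to $P\otimes ds$ on the respective time intervals, so all the expectations are finite. -/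

import Mathlib

open MeasureTheory ProbabilityTheory Filter Topology
open scoped NNReal ENNReal RealInnerProductSpace

noncomputable section

namespace DiscountedControl

/-- An `N`-dimensional Wiener process: the coordinates are independent real Brownian motions
(started at `0`, with a.s. continuous paths). -/
structure IsWienerProcess {Ω : Type*} [MeasurableSpace Ω] {N : ℕ}
    (W : ℝ≥0 → Ω → EuclideanSpace ℝ (Fin N)) (P : Measure Ω) : Prop where
  measurable : ∀ t, Measurable (W t)
  isBrownianReal : ∀ j : Fin N, IsBrownianReal (fun t ω => W t ω j) P
  indep : iIndepFun (fun (j : Fin N) (ω : Ω) (t : ℝ≥0) => W t ω j) P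

/-- The natural filtration of `W` augmented by the `P`-null sets. -/
def augmentedFiltration {Ω : Type*} [mΩ : MeasurableSpace Ω] {N : ℕ}
    {W : ℝ≥0 → Ω → EuclideanSpace ℝ (Fin N)} (hW : ∀ t, Measurable (W t)) (P : Measure Ω) :
    Filtration ℝ≥0 mΩ :=
  Filtration.natural W (fun t => (hW t).stronglyMeasurable) ⊔
    Filtration.const ℝ≥0 (MeasurableSpace.generateFrom {A : Set Ω | MeasurableSet A ∧ P A = 0})
      (MeasurableSpace.generateFrom_le fun _ hA => hA.1)

/-- The admissible controls: `D`-valued processes, progressively measurable with respect to the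
augmented natural filtration of the Wiener process. -/
def IsControl {Ω : Type*} [MeasurableSpace Ω] {N k : ℕ} {P : Measure Ω}
    {W : ℝ≥0 → Ω → EuclideanSpace ℝ (Fin N)} (hW : IsWienerProcess W P)
    {D : Set (EuclideanSpace ℝ (Fin k))} (δ : ℝ≥0 → Ω → D) : Prop :=
  IsProgressive (augmentedFiltration hW.measurable P) δ

/-- `Y` is a strong solution of `dY_t = i(Y_t, δ_t) dt + dW_t` on `[0, ∞)` with `Y_0 = y`. -/
structure IsStrongSolution {Ω : Type*} [MeasurableSpace Ω] {N k : ℕ} {P : Measure Ω}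
    {W : ℝ≥0 → Ω → EuclideanSpace ℝ (Fin N)} (hW : IsWienerProcess W P)
    {D : Set (EuclideanSpace ℝ (Fin k))}
    (i : EuclideanSpace ℝ (Fin N) → D → EuclideanSpace ℝ (Fin N))
    (δ : ℝ≥0 → Ω → D) (y : EuclideanSpace ℝ (Fin N))
    (Y : ℝ≥0 → Ω → EuclideanSpace ℝ (Fin N)) : Prop where
  adapted : Adapted (augmentedFiltration hW.measurable P) Y
  continuous_paths : ∀ᵐ ω ∂P, Continuous fun t => Y t ω
  equation : ∀ᵐ ω ∂P, ∀ t : ℝ≥0,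
    Y t ω = y + (∫ s in (0 : ℝ)..t, i (Y s.toNNReal ω) (δ s.toNNReal ω)) + W t ω

/-- The standing assumption on the coefficients: continuity, Lipschitz continuity in the state
uniformly in the control (constant `L₁ > 0`), and the one-sided Lipschitz condition on the drift
(constant `L₂ ≠ 0`). -/
structure CoefficientAssumption {N k : ℕ} {D : Set (EuclideanSpace ℝ (Fin k))}
    (f h : EuclideanSpace ℝ (Fin N) → D → ℝ) (g : EuclideanSpace ℝ (Fin N) → ℝ)
    (i : EuclideanSpace ℝ (Fin N) → D → EuclideanSpace ℝ (Fin N)) (L₁ L₂ : ℝ) : Prop where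
  continuous_f : Continuous fun p : EuclideanSpace ℝ (Fin N) × D => f p.1 p.2
  continuous_h : Continuous fun p : EuclideanSpace ℝ (Fin N) × D => h p.1 p.2
  continuous_g : Continuous g
  continuous_i : Continuous fun p : EuclideanSpace ℝ (Fin N) × D => i p.1 p.2
  L₁_pos : 0 < L₁
  L₂_ne_zero : L₂ ≠ 0
  lipschitz_g : ∀ y y', |g y - g y'| ≤ L₁ * ‖y - y'‖
  lipschitz_f : ∀ y y' d, |f y d - f y' d| ≤ L₁ * ‖y - y'‖
  lipschitz_h : ∀ y y' d, |h y d - h y' d| ≤ L₁ * ‖y - y'‖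
  lipschitz_i : ∀ y y' d, ‖i y d - i y' d‖ ≤ L₁ * ‖y - y'‖
  one_sided_lipschitz : ∀ y y' d, ⟪y - y', i y d - i y' d⟫ ≤ L₂ * ‖y - y'‖ ^ 2

/-- The discount factor `exp (∫₀ˢ h(Y_k, δ_k) dk)`. -/
def discountFactor {Ω : Type*} {N k : ℕ} {D : Set (EuclideanSpace ℝ (Fin k))}
    (h : EuclideanSpace ℝ (Fin N) → D → ℝ)
    (Y : ℝ≥0 → Ω → EuclideanSpace ℝ (Fin N)) (δ : ℝ≥0 → Ω → D) (s : ℝ) (ω : Ω) : ℝ :=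
  Real.exp (∫ r in (0 : ℝ)..s, h (Y r.toNNReal ω) (δ r.toNNReal ω))

/-- The infinite-horizon assumption: a deterministic bound `κ(t, n)`, continuous in `t > 0`, on the
expected discounted running reward, uniform over all admissible controls and over all starting
points in the closed ball of radius `n`, with `κ(t, n)` and `exp(L₂ t) κ(t, n)` integrable over
`t > 0`. -/
def InfiniteHorizonAssumption {Ω : Type*} [MeasurableSpace Ω] {N k : ℕ} {P : Measure Ω}
    {W : ℝ≥0 → Ω → EuclideanSpace ℝ (Fin N)} (hW : IsWienerProcess W P)
    {D : Set (EuclideanSpace ℝ (Fin k))}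
    (f h : EuclideanSpace ℝ (Fin N) → D → ℝ)
    (i : EuclideanSpace ℝ (Fin N) → D → EuclideanSpace ℝ (Fin N)) (L₂ : ℝ) : Prop :=
  ∃ κ : ℝ → ℕ → ℝ,
    (∀ n, ContinuousOn (fun t => κ t n) (Set.Ioi 0)) ∧
    (∀ δ : ℝ≥0 → Ω → D, IsControl hW δ →
      ∀ (n : ℕ) (y : EuclideanSpace ℝ (Fin N)), ‖y‖ ≤ n →
      ∀ Y : ℝ≥0 → Ω → EuclideanSpace ℝ (Fin N), IsStrongSolution hW i δ y Y →
      ∀ t : ℝ≥0, 0 < t →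
        ∫⁻ ω, ENNReal.ofReal (discountFactor h Y δ t ω * max |f (Y t ω) (δ t ω)| 1) ∂P
          ≤ ENNReal.ofReal (κ t n)) ∧
    (∀ n, IntegrableOn (fun t => κ t n) (Set.Ioi 0)) ∧
    (∀ n, IntegrableOn (fun t => Real.exp (L₂ * t) * κ t n) (Set.Ioi 0))

/-- The discounted running reward `exp (∫₀ˢ h(Y_k, δ_k) dk) φ(Y_s, δ_s)`. -/
def discountedReward {Ω : Type*} {N k : ℕ} {D : Set (EuclideanSpace ℝ (Fin k))}
    (h φ : EuclideanSpace ℝ (Fin N) → D → ℝ)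
    (Y : ℝ≥0 → Ω → EuclideanSpace ℝ (Fin N)) (δ : ℝ≥0 → Ω → D) (s : ℝ) (ω : Ω) : ℝ :=
  discountFactor h Y δ s ω * φ (Y s.toNNReal ω) (δ s.toNNReal ω)

/-- The expected discounted reward `E ∫_I exp (∫₀ˢ h(Y_k, δ_k) dk) φ(Y_s, δ_s) ds` over the time
set `I ⊆ [0, ∞)`. -/
def expectedReward {Ω : Type*} [MeasurableSpace Ω] (P : Measure Ω) {N k : ℕ}
    {D : Set (EuclideanSpace ℝ (Fin k))} (h φ : EuclideanSpace ℝ (Fin N) → D → ℝ)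
    (Y : ℝ≥0 → Ω → EuclideanSpace ℝ (Fin N)) (δ : ℝ≥0 → Ω → D) (I : Set ℝ) : ℝ :=
  ∫ ω, (∫ s in I, discountedReward h φ Y δ s ω) ∂P

end DiscountedControl

end

/-! By Fubini each expected reward is a time integral of the expected discounted reward at a fixed
time, so two limits suffice: one in `ω` at fixed time, one in time.

In time, the bound `κ(t, m)` with `‖y‖ ≤ m` dominates all these expectations at once and is
integrable. It also gives integrability on `Ω × [0, ∞)`, for the limit pair as well, since that pair
is admissible (`tendsto_integral_setIntegral_of_lintegral_le`).

At fixed time, `κ` bounds only the expectation, which does not allow passage to the limit. The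
drift, `h` and `f` grow at most linearly because `D` is compact, so Grönwall's inequality bounds the
state by the Wiener path uniformly in the control. The reward at time `s` is then at most `exp (a +
b ∫₀ˢ ‖W‖ + c ‖W_s‖)` (`exists_ae_abs_discountedReward_le`), which is integrable by Gaussian
exponential moments and Jensen. Pointwise convergence of the reward (`ae_tendsto_discountedReward`)
comes from dominated convergence inside the exponent, along almost every path. -/

namespace DiscountedControl

/-! ### Joint measurability of processes -/

/-- A process with measurable marginals and almost surely continuous paths is indistinguishable from
a jointly measurable process all of whose paths are continuous. -/
lemma exists_continuous_modification {Ω E : Type*} [MeasurableSpace Ω] {P : Measure Ω}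
    [NormedAddCommGroup E] [MeasurableSpace E] [BorelSpace E]
    {U : ℝ≥0 → Ω → E} (hU : ∀ t, Measurable (U t))
    (hc : ∀ᵐ ω ∂P, Continuous fun t => U t ω) :
    ∃ V : ℝ≥0 → Ω → E, Measurable (Function.uncurry V) ∧ (∀ ω, Continuous fun t => V t ω) ∧
      ∀ᵐ ω ∂P, ∀ t, U t ω = V t ω := by
  classical
  obtain ⟨S, hS, hSm, hSP⟩ := Eventually.exists_measurable_mem hc
  have hcont : ∀ ω, Continuous fun t => S.indicator (U t) ω := fun ω => by
    by_cases hω : ω ∈ S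
    · simpa [Set.indicator_of_mem hω] using hSP ω hω
    · simpa [Set.indicator_of_notMem hω] using continuous_const
  refine ⟨fun t => S.indicator (U t), ?_, hcont, ?_⟩
  · exact measurable_uncurry_of_continuous_of_measurable hcont fun t => (hU t).indicator hSm
  · filter_upwards [hS] with ω hω t
    rw [Set.indicator_of_mem hω]

/-- A progressive process is jointly measurable. -/
lemma measurable_uncurry_of_isProgressive {Ω β : Type*} [mΩ : MeasurableSpace Ω]
    [TopologicalSpace β] [TopologicalSpace.PseudoMetrizableSpace β] [MeasurableSpace β]
    [BorelSpace β] {𝓕 : Filtration ℝ≥0 mΩ} {u : ℝ≥0 → Ω → β} (hu : IsProgressive 𝓕 u) :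
    Measurable (Function.uncurry u) := by
  -- Freezing time at `n` leaves only the restriction to `[0, n]`, which progressivity controls; at
  -- each point the frozen process is eventually equal to `u`.
  refine measurable_of_tendsto_metrizable
    (f := fun (n : ℕ) (p : ℝ≥0 × Ω) => u (min p.1 n) p.2) (fun n => ?_) ?_
  · have h1 : Measurable fun p : Set.Iic (n : ℝ≥0) × Ω => u p.1 p.2 :=
      (hu n).mono (sup_le_sup le_rfl (MeasurableSpace.comap_mono (𝓕.le n))) le_rfl
    have h2 : Measurable fun p : ℝ≥0 × Ω =>
        ((⟨min p.1 n, Set.mem_Iic.2 (min_le_right _ _)⟩ : Set.Iic (n : ℝ≥0)), p.2) := by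
      refine Measurable.prodMk (Measurable.subtype_mk ?_) measurable_snd
      exact measurable_fst.min measurable_const
    exact h1.comp h2
  · refine tendsto_pi_nhds.2 fun p => tendsto_const_nhds.congr' ?_
    obtain ⟨m, hm⟩ := exists_nat_ge p.1
    filter_upwards [eventually_ge_atTop m] with n hn
    rw [min_eq_left (hm.trans (by exact_mod_cast hn))]
    rfl

/-- Primitives of jointly measurable processes are jointly measurable. -/
lemma measurable_primitive {Ω : Type*} [MeasurableSpace Ω] {H : ℝ → Ω → ℝ}
    (hH : Measurable (Function.uncurry H)) :
    Measurable fun p : Ω × ℝ => ∫ r in (0 : ℝ)..p.2, H r p.1 := by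
  -- The moving interval becomes an indicator of a measurable set in the product, so that
  -- measurability of parametric integrals applies.
  have key : ∀ a b : (Ω × ℝ) → ℝ, Measurable a → Measurable b →
      Measurable fun p : Ω × ℝ => ∫ r in Set.Ioc (a p) (b p), H r p.1 := fun a b ha hb => by
    have hm : MeasurableSet {q : (Ω × ℝ) × ℝ | a q.1 < q.2 ∧ q.2 ≤ b q.1} :=
      (measurableSet_lt (ha.comp measurable_fst) measurable_snd).inter
        (measurableSet_le measurable_snd (hb.comp measurable_fst))
    have h1 : Measurable fun q : (Ω × ℝ) × ℝ => H q.2 q.1.1 :=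
      hH.comp (measurable_snd.prodMk (measurable_fst.comp measurable_fst))
    have h2 := (h1.indicator hm).stronglyMeasurable.integral_prod_right' (ν := volume)
    convert h2.measurable using 2 with p
    rw [← integral_indicator measurableSet_Ioc]
    rfl
  simp only [intervalIntegral]
  exact (key _ _ measurable_const measurable_snd).sub (key _ _ measurable_snd measurable_const)

/-! ### Grönwall and an elementary exponential bound -/

/-- Integrated form of Grönwall's inequality. -/
lemma integral_le_exp_mul_integral_of_le_add_mul_integral {u w : ℝ → ℝ} {L : ℝ} (hL : 0 ≤ L)
    (hu : Continuous u) (hw : Continuous w) (hw0 : ∀ t, 0 ≤ t → 0 ≤ w t)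
    (h : ∀ t, 0 ≤ t → u t ≤ w t + L * ∫ r in (0 : ℝ)..t, u r) {t : ℝ} (ht : 0 ≤ t) :
    ∫ r in (0 : ℝ)..t, u r ≤ Real.exp (L * t) * ∫ r in (0 : ℝ)..t, w r := by
  -- `ψ' = exp (-Lt) (u - L ∫ u) - w ≤ (exp (-Lt) - 1) w ≤ 0`, so `w` need not be monotone.
  set ψ : ℝ → ℝ := fun t =>
    Real.exp (-(L * t)) * (∫ r in (0 : ℝ)..t, u r) - ∫ r in (0 : ℝ)..t, w r with hψ
  have hd : ∀ t, HasDerivAt ψ (Real.exp (-(L * t)) * (-L) * (∫ r in (0 : ℝ)..t, u r)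
      + Real.exp (-(L * t)) * u t - w t) t := fun t => by
    have h1 : HasDerivAt (fun t => Real.exp (-(L * t))) (Real.exp (-(L * t)) * (-L)) t := by
      have := ((hasDerivAt_id t).const_mul L).neg.exp
      simpa using this
    exact (h1.mul (hu.integral_hasStrictDerivAt 0 t).hasDerivAt).sub
      (hw.integral_hasStrictDerivAt 0 t).hasDerivAt
  have hanti : AntitoneOn ψ (Set.Ici 0) := by
    refine antitoneOn_of_deriv_nonpos (convex_Ici 0)
      (fun x _ => (hd x).continuousAt.continuousWithinAt)
      (fun x _ => (hd x).differentiableAt.differentiableWithinAt) fun x hx => ?_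
    rw [interior_Ici] at hx
    have hx0 : (0 : ℝ) ≤ x := le_of_lt hx
    rw [(hd x).deriv]
    have h1 := mul_le_mul_of_nonneg_left (h x hx0) (Real.exp_pos (-(L * x))).le
    have h2 : Real.exp (-(L * x)) ≤ 1 := Real.exp_le_one_iff.2 (by nlinarith)
    have h3 := mul_le_mul_of_nonneg_right h2 (hw0 x hx0)
    linarith
  have := hanti (Set.self_mem_Ici) ht ht
  have h0 : ψ 0 = 0 := by simp [hψ]
  rw [h0] at this
  have h4 : Real.exp (-(L * t)) * (∫ r in (0 : ℝ)..t, u r) ≤ ∫ r in (0 : ℝ)..t, w r := by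
    simpa [hψ] using this
  have h5 := mul_le_mul_of_nonneg_left h4 (Real.exp_pos (L * t)).le
  rwa [← mul_assoc, ← Real.exp_add, add_neg_cancel, Real.exp_zero, one_mul] at h5

/-- The Euclidean norm is at most `N` times the largest coordinate in absolute value, and the
exponential of that is one of the summands. This reduces norms to one-dimensional Gaussian moments;
the `1` covers `N = 0`. -/
lemma exp_mul_norm_le_one_add_sum {N : ℕ} (x : EuclideanSpace ℝ (Fin N)) {c : ℝ} (hc : 0 ≤ c) :
    Real.exp (c * ‖x‖)
      ≤ 1 + ∑ j, (Real.exp ((c * N) * x j) + Real.exp (-(c * N) * x j)) := by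
  have hs : ∀ j, 0 ≤ Real.exp ((c * N) * x j) + Real.exp (-(c * N) * x j) := fun j => by positivity
  rcases Nat.eq_zero_or_pos N with hN | hN
  · subst hN
    have : x = 0 := Subsingleton.elim _ _
    simp [this]
  · have : Nonempty (Fin N) := ⟨⟨0, hN⟩⟩
    obtain ⟨j, hj⟩ := Finite.exists_max fun j => |x j|
    have h1 : ‖x‖ ≤ N * |x j| := by
      calc ‖x‖ ≤ ∑ l, |x l| := by
            rw [EuclideanSpace.norm_eq]
            refine Real.sqrt_le_iff.2 ⟨Finset.sum_nonneg fun _ _ => abs_nonneg _, ?_⟩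
            simpa using Finset.sum_sq_le_sq_sum_of_nonneg (s := Finset.univ)
              (f := fun l => |x l|) fun _ _ => abs_nonneg _
        _ ≤ ∑ _l : Fin N, |x j| := Finset.sum_le_sum fun l _ => hj l
        _ = N * |x j| := by simp
    have h2 : Real.exp (c * ‖x‖) ≤ Real.exp ((c * N) * |x j|) := by
      refine Real.exp_le_exp.2 ?_
      rw [mul_assoc]
      exact mul_le_mul_of_nonneg_left h1 hc
    have h3 : Real.exp ((c * N) * |x j|)
        ≤ Real.exp ((c * N) * x j) + Real.exp (-(c * N) * x j) := by
      rcases abs_choice (x j) with h | h <;> rw [h]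
      · exact le_add_of_nonneg_right (Real.exp_pos _).le
      · rw [mul_neg, ← neg_mul]
        exact le_add_of_nonneg_left (Real.exp_pos _).le
    have h4 := Finset.single_le_sum (fun l _ => hs l) (Finset.mem_univ j)
    linarith

/-! ### Exponential moments of the Wiener process -/

section Wiener

variable {Ω : Type*} [MeasurableSpace Ω] {P : Measure Ω} {N : ℕ}
  {W : ℝ≥0 → Ω → EuclideanSpace ℝ (Fin N)}

lemma IsWienerProcess.ae_continuous (hW : IsWienerProcess W P) :
    ∀ᵐ ω ∂P, Continuous fun t => W t ω := by
  have h : ∀ᵐ ω ∂P, ∀ j, Continuous fun t => W t ω j :=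
    ae_all_iff.2 fun j => (hW.isBrownianReal j).cont
  filter_upwards [h] with ω hω
  exact (PiLp.continuous_toLp 2 _).comp (continuous_pi hω)

lemma IsWienerProcess.exp_integrable_and_integral (hW : IsWienerProcess W P) (j : Fin N) (c : ℝ)
    (t : ℝ≥0) : Integrable (fun ω => Real.exp (c * W t ω j)) P ∧
      ∫ ω, Real.exp (c * W t ω j) ∂P = Real.exp (t * c ^ 2 / 2) := by
  have hl := ((hW.isBrownianReal j).toIsPreBrownianReal.hasLaw_eval t)
  have hm := mgf_gaussianReal hl.map_eq c
  simp only [mgf, zero_mul, zero_add] at hm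
  refine ⟨?_, hm⟩
  -- A non-integrable function has Bochner integral `0`, whereas the Gaussian moment generating
  -- function is positive.
  by_contra hcon
  rw [integral_undef hcon] at hm
  exact (Real.exp_pos _).ne hm

/-- Exponential moments of the norm of a Wiener process. -/
lemma IsWienerProcess.exp_norm_integrable [IsProbabilityMeasure P]
    (hW : IsWienerProcess W P) {c : ℝ} (hc : 0 ≤ c) (t : ℝ≥0) :
    Integrable (fun ω => Real.exp (c * ‖W t ω‖)) P ∧
      ∫ ω, Real.exp (c * ‖W t ω‖) ∂P ≤ 1 + N * (2 * Real.exp (t * (c * N) ^ 2 / 2)) := by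
  have hi : Integrable (fun ω => 1 + ∑ j, (Real.exp ((c * N) * W t ω j)
      + Real.exp (-(c * N) * W t ω j))) P :=
    (integrable_const _).add (integrable_finsetSum _ fun j _ =>
      (hW.exp_integrable_and_integral j _ t).1.add (hW.exp_integrable_and_integral j _ t).1)
  have hi2 : Integrable (fun ω => Real.exp (c * ‖W t ω‖)) P := by
    refine hi.mono' (((hW.measurable t).norm.const_mul c).exp.aestronglyMeasurable)
      (ae_of_all _ fun ω => ?_)
    rw [Real.norm_of_nonneg (Real.exp_pos _).le]
    exact exp_mul_norm_le_one_add_sum _ hc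
  refine ⟨hi2, (integral_mono hi2 hi fun ω => exp_mul_norm_le_one_add_sum _ hc).trans_eq ?_⟩
  have : ∀ j : Fin N, ∫ ω, (Real.exp ((c * N) * W t ω j) + Real.exp (-(c * N) * W t ω j)) ∂P
      = 2 * Real.exp (t * (c * N) ^ 2 / 2) := fun j => by
    rw [integral_add (hW.exp_integrable_and_integral j _ t).1
      (hW.exp_integrable_and_integral j _ t).1, (hW.exp_integrable_and_integral j _ t).2,
      (hW.exp_integrable_and_integral j _ t).2, neg_sq]
    ring
  rw [integral_add (integrable_const _), integral_finsetSum]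
  · simp only [this]
    simp
  · exact fun j _ =>
      (hW.exp_integrable_and_integral j _ t).1.add (hW.exp_integrable_and_integral j _ t).1
  · exact integrable_finsetSum _ fun j _ =>
      (hW.exp_integrable_and_integral j _ t).1.add (hW.exp_integrable_and_integral j _ t).1

/-- Exponential moments of a time integral of the norm of a Wiener process. -/
lemma IsWienerProcess.integrable_exp_integral_norm [IsProbabilityMeasure P]
    (hW : IsWienerProcess W P) {c s : ℝ}
    (hc : 0 ≤ c) (hs : 0 < s) :
    Integrable (fun ω => Real.exp (c * ∫ r in (0 : ℝ)..s, ‖W r.toNNReal ω‖)) P := by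
  obtain ⟨V, hV, hVc, hWV⟩ := exists_continuous_modification hW.measurable hW.ae_continuous
  have hVr : Measurable (Function.uncurry fun (r : ℝ) ω => V r.toNNReal ω) :=
    hV.comp ((measurable_real_toNNReal.comp measurable_fst).prodMk measurable_snd)
  have hVn : Measurable (Function.uncurry fun (r : ℝ) ω => ‖V r.toNNReal ω‖) := hVr.norm
  have hcont : ∀ ω, Continuous fun r : ℝ => ‖V r.toNNReal ω‖ := fun ω =>
    ((hVc ω).comp continuous_real_toNNReal).norm
  suffices h : Integrable (fun ω => Real.exp (c * ∫ r in (0 : ℝ)..s, ‖V r.toNNReal ω‖)) P by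
    refine h.congr ?_
    filter_upwards [hWV] with ω hω
    simp only [hω]
  have hVe : ∀ r : ℝ≥0, Integrable (fun ω => Real.exp (c * s * ‖V r ω‖)) P ∧
      ∫ ω, Real.exp (c * s * ‖V r ω‖) ∂P ≤ 1 + N * (2 * Real.exp (r * (c * s * N) ^ 2 / 2)) :=
    fun r => by
      have h1 := hW.exp_norm_integrable (mul_nonneg hc hs.le) r
      have h2 : (fun ω => Real.exp (c * s * ‖W r ω‖)) =ᵐ[P]
          fun ω => Real.exp (c * s * ‖V r ω‖) := by
        filter_upwards [hWV] with ω hω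
        simp only [hω]
      exact ⟨h1.1.congr h2, (integral_congr_ae h2) ▸ h1.2⟩
  have hprod : Integrable (fun p : Ω × ℝ => Real.exp (c * s * ‖V p.2.toNNReal p.1‖))
      (P.prod (volume.restrict (Set.Ioc 0 s))) := by
    have hm : Measurable fun p : Ω × ℝ => Real.exp (c * s * ‖V p.2.toNNReal p.1‖) :=
      ((hVn.comp measurable_swap).const_mul _).exp
    rw [integrable_prod_iff' hm.aestronglyMeasurable]
    refine ⟨ae_of_all _ fun r => (hVe r.toNNReal).1, ?_⟩
    have hm' : StronglyMeasurable fun r : ℝ =>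
        ∫ ω, ‖Real.exp (c * s * ‖V r.toNNReal ω‖)‖ ∂P :=
      StronglyMeasurable.integral_prod_left' (μ := P)
        (f := fun p : Ω × ℝ => ‖Real.exp (c * s * ‖V p.2.toNNReal p.1‖)‖)
        hm.norm.stronglyMeasurable
    refine Integrable.mono' (g := fun _ => 1 + N * (2 * Real.exp (s * (c * s * N) ^ 2 / 2)))
      (integrable_const _) hm'.aestronglyMeasurable ?_
    filter_upwards [ae_restrict_mem measurableSet_Ioc] with r hr
    rw [Real.norm_of_nonneg (integral_nonneg fun _ => norm_nonneg _)]
    simp only [Real.norm_eq_abs, Real.abs_exp]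
    refine (hVe r.toNNReal).2.trans ?_
    have : ((r.toNNReal : ℝ≥0) : ℝ) ≤ s := by rw [Real.coe_toNNReal _ hr.1.le]; exact hr.2
    gcongr
  -- Jensen for the uniform law on `(0, s]`: `exp (c ∫₀ˢ ‖V‖) ≤ s⁻¹ ∫₀ˢ exp (c s ‖V_r‖) dr`.
  have hint := (hprod.integral_prod_left).const_mul s⁻¹
  refine hint.mono' ?_ (ae_of_all _ fun ω => ?_)
  · exact (((measurable_primitive hVn).comp (measurable_id.prodMk measurable_const)).const_mul
      c).exp.aestronglyMeasurable
  · rw [Real.norm_of_nonneg (Real.exp_pos _).le]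
    have hvol : volume.real (Set.Ioc 0 s) = s := by simp [hs.le]
    have : NeZero (volume.restrict (Set.Ioc 0 s)) := ⟨by simp [hs]⟩
    have hj := convexOn_exp.map_average_le (μ := volume.restrict (Set.Ioc 0 s))
      (f := fun r => c * s * ‖V r.toNNReal ω‖) Real.continuous_exp.continuousOn isClosed_univ
      (by simp) (((hcont ω).const_mul _).integrableOn_Ioc)
      ((Real.continuous_exp.comp ((hcont ω).const_mul _)).integrableOn_Ioc)
    rw [setAverage_eq, setAverage_eq, hvol, integral_const_mul, smul_eq_mul, smul_eq_mul] at hj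
    rw [intervalIntegral.integral_of_le hs.le]
    convert hj using 2
    field_simp

/-- Integrability of the exponential envelope of a Wiener process. -/
lemma IsWienerProcess.integrable_exp_envelope [IsProbabilityMeasure P]
    (hW : IsWienerProcess W P) {a b c s : ℝ}
    (hb : 0 ≤ b) (hc : 0 ≤ c) (hs : 0 < s) :
    Integrable (fun ω => Real.exp (a + b * (∫ r in (0 : ℝ)..s, ‖W r.toNNReal ω‖)
      + c * ‖W s.toNNReal ω‖)) P := by
  -- The doubled constants serve `exp (A + B) ≤ exp (2A) + exp (2B)`, which avoids any independence
  -- between the two terms.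
  have h1 := hW.integrable_exp_integral_norm (mul_nonneg zero_le_two hb) hs
  have h2 := (hW.exp_norm_integrable (mul_nonneg zero_le_two hc) s.toNNReal).1
  -- Measurability of the exponents is recovered as the logarithm of an integrable exponential.
  have hlog : ∀ {X : Ω → ℝ}, Integrable (fun ω => Real.exp (X ω)) P → AEMeasurable X P :=
    fun {X} hX => by simpa using hX.aemeasurable.log
  refine ((h1.add h2).const_mul (Real.exp a)).mono' ?_ (ae_of_all _ fun ω => ?_)
  · have e1 := (hlog h1).mul_const (1 / 2)
    have e2 := (hlog h2).mul_const (1 / 2)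
    refine (((e1.add e2).const_add a).exp.congr (ae_of_all _ fun ω => ?_)).aestronglyMeasurable
    simp only [Pi.add_apply]
    congr 1
    ring
  · rw [Real.norm_of_nonneg (Real.exp_pos _).le, add_assoc, Real.exp_add]
    refine mul_le_mul_of_nonneg_left ?_ (Real.exp_pos _).le
    set A := b * ∫ r in (0 : ℝ)..s, ‖W r.toNNReal ω‖ with hA
    set B := c * ‖W s.toNNReal ω‖ with hB
    have e1 : Real.exp (2 * b * ∫ r in (0 : ℝ)..s, ‖W r.toNNReal ω‖) = Real.exp A ^ 2 := by
      rw [← Real.exp_nat_mul, hA]; push_cast; ring_nf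
    have e2 : Real.exp (2 * c * ‖W s.toNNReal ω‖) = Real.exp B ^ 2 := by
      rw [← Real.exp_nat_mul, hB]; push_cast; ring_nf
    simp only [Pi.add_apply]
    rw [e1, e2, Real.exp_add]
    nlinarith [sq_nonneg (Real.exp A - Real.exp B), sq_nonneg (Real.exp A), sq_nonneg (Real.exp B)]

end Wiener

/-! ### Iterated integrals over growing time intervals -/

section Fubini

variable {Ω : Type*} [MeasurableSpace Ω] {P : Measure Ω} [SFinite P]

/-- Tonelli, with time as the outer variable; the bound at positive times suffices because `{0}` is
null. -/
lemma integrable_prod_of_lintegral_le {G : ℝ → Ω → ℝ} {K : ℝ → ℝ}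
    (hG : AEStronglyMeasurable (fun p : Ω × ℝ => G p.2 p.1)
      (P.prod (volume.restrict (Set.Ici 0))))
    (hK : IntegrableOn K (Set.Ioi 0))
    (hGK : ∀ t, 0 < t → ∫⁻ ω, ENNReal.ofReal |G t ω| ∂P ≤ ENNReal.ofReal (K t)) :
    Integrable (fun p : Ω × ℝ => G p.2 p.1) (P.prod (volume.restrict (Set.Ici 0))) := by
  refine ⟨hG, ?_⟩
  rw [hasFiniteIntegral_iff_norm, lintegral_prod_symm _ hG.norm.aemeasurable.ennreal_ofReal,
    ← restrict_Ioi_eq_restrict_Ici]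
  refine lt_of_le_of_lt (lintegral_mono_ae ?_) (Integrable.lintegral_lt_top hK)
  filter_upwards [ae_restrict_mem measurableSet_Ioi] with t ht
  exact hGK t ht

/-- Dominated convergence for iterated integrals over growing time intervals, with a bound on the
expectations at each time. -/
lemma tendsto_integral_setIntegral_of_lintegral_le {G : ℕ → ℝ → Ω → ℝ} {G' : ℝ → Ω → ℝ}
    {K : ℝ → ℝ} {T : ℕ → ℝ} (hT : Tendsto T atTop atTop)
    (hG : ∀ n, Integrable (fun p : Ω × ℝ => G n p.2 p.1)
      (P.prod (volume.restrict (Set.Ici 0))))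
    (hG' : Integrable (fun p : Ω × ℝ => G' p.2 p.1) (P.prod (volume.restrict (Set.Ici 0))))
    (hK : IntegrableOn K (Set.Ioi 0))
    (hGK : ∀ n t, 0 < t → ∫⁻ ω, ENNReal.ofReal |G n t ω| ∂P ≤ ENNReal.ofReal (K t))
    (hlim : ∀ t, 0 < t → Tendsto (fun n => ∫ ω, G n t ω ∂P) atTop (𝓝 (∫ ω, G' t ω ∂P))) :
    Tendsto (fun n => ∫ ω, (∫ s in Set.Icc 0 (T n), G n s ω) ∂P) atTop
      (𝓝 (∫ ω, (∫ s in Set.Ici 0, G' s ω) ∂P)) := by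
  have hsub : ∀ n, Integrable (fun p : Ω × ℝ => G n p.2 p.1)
      (P.prod (volume.restrict (Set.Icc 0 (T n)))) := fun n =>
    (hG n).mono_measure
      (Measure.prod_mono le_rfl (Measure.restrict_mono Set.Icc_subset_Ici_self le_rfl))
  -- The horizon `T n` is moved into an indicator, so that all time integrals share one domain.
  have e1 : ∀ n, ∫ ω, (∫ s in Set.Icc 0 (T n), G n s ω) ∂P
      = ∫ s in Set.Ioi 0, (Set.Iic (T n)).indicator (fun s => ∫ ω, G n s ω ∂P) s := fun n => by
    rw [integral_integral_swap (f := fun ω s => G n s ω) (hsub n), ← integral_Ici_eq_integral_Ioi,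
      setIntegral_indicator measurableSet_Iic, Set.Ici_inter_Iic]
  simp only [e1]
  rw [integral_integral_swap (f := fun ω s => G' s ω) hG', integral_Ici_eq_integral_Ioi]
  refine tendsto_integral_of_dominated_convergence (fun t => |K t|) (fun n => ?_) hK.abs
    (fun n => ?_) ?_
  · have := (hG n).integral_prod_right.aestronglyMeasurable.indicator
      (measurableSet_Iic (a := T n))
    rwa [← restrict_Ioi_eq_restrict_Ici] at this
  · filter_upwards [ae_restrict_mem measurableSet_Ioi] with t ht
    refine (norm_indicator_le_norm_self _ _).trans
      ((norm_integral_le_lintegral_norm _).trans ?_)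
    refine (ENNReal.toReal_mono ENNReal.ofReal_ne_top (hGK n t ht)).trans ?_
    rw [ENNReal.toReal_ofReal']
    exact max_le (le_abs_self _) (abs_nonneg _)
  · filter_upwards [ae_restrict_mem measurableSet_Ioi] with t ht
    refine (hlim t ht).congr' ?_
    filter_upwards [hT.eventually_ge_atTop t] with n hn
    rw [Set.indicator_of_mem (Set.mem_Iic.2 hn)]

end Fubini

/-! ### Linear growth and pathwise bounds for the state -/

/-- A continuous function which is Lipschitz in the state, uniformly in a compact control set, has
linear growth. -/
lemma exists_linear_growth {N k : ℕ} {D : Set (EuclideanSpace ℝ (Fin k))} (hD : IsCompact D)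
    {F : Type*} [NormedAddCommGroup F] {φ : EuclideanSpace ℝ (Fin N) → D → F} {L : ℝ}
    (hφ : Continuous fun p : EuclideanSpace ℝ (Fin N) × D => φ p.1 p.2)
    (hL : ∀ y y' d, ‖φ y d - φ y' d‖ ≤ L * ‖y - y'‖) :
    ∃ C, ∀ y d, ‖φ y d‖ ≤ C + L * ‖y‖ := by
  have : CompactSpace D := isCompact_iff_compactSpace.1 hD
  obtain ⟨C, hC⟩ := (isCompact_range (f := fun d : D => ‖φ 0 d‖) (by fun_prop)).bddAbove
  refine ⟨C, fun y d => ?_⟩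
  have h1 : ‖φ 0 d‖ ≤ C := hC ⟨d, rfl⟩
  have h2 := hL y 0 d
  rw [sub_zero] at h2
  have h3 := norm_sub_norm_le (φ y d) (φ 0 d)
  linarith

lemma discountedReward_congr {Ω : Type*} {N k : ℕ} {D : Set (EuclideanSpace ℝ (Fin k))}
    {h φ : EuclideanSpace ℝ (Fin N) → D → ℝ} {δ : ℝ≥0 → Ω → D}
    {Y V : ℝ≥0 → Ω → EuclideanSpace ℝ (Fin N)} {ω : Ω} (hω : ∀ t, Y t ω = V t ω) (s : ℝ) :
    discountedReward h φ Y δ s ω = discountedReward h φ V δ s ω := by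
  simp only [discountedReward, discountFactor, hω]

section Solution

variable {Ω : Type*} [MeasurableSpace Ω] {P : Measure Ω} {N k : ℕ}
  {W : ℝ≥0 → Ω → EuclideanSpace ℝ (Fin N)} {hW : IsWienerProcess W P}
  {D : Set (EuclideanSpace ℝ (Fin k))} {h φ : EuclideanSpace ℝ (Fin N) → D → ℝ}
  {i : EuclideanSpace ℝ (Fin N) → D → EuclideanSpace ℝ (Fin N)}
  {δ : ℝ≥0 → Ω → D} {y : EuclideanSpace ℝ (Fin N)} {Y : ℝ≥0 → Ω → EuclideanSpace ℝ (Fin N)}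
  {C L : ℝ}

lemma IsControl.measurable_uncurry (hδ : IsControl hW δ) : Measurable (Function.uncurry δ) :=
  measurable_uncurry_of_isProgressive hδ

lemma IsStrongSolution.exists_measurable_modification (hY : IsStrongSolution hW i δ y Y) :
    ∃ V : ℝ≥0 → Ω → EuclideanSpace ℝ (Fin N), Measurable (Function.uncurry V) ∧
      ∀ᵐ ω ∂P, ∀ t, Y t ω = V t ω := by
  obtain ⟨V, hV, -, h⟩ := exists_continuous_modification
    (fun t => (hY.adapted t).mono (Filtration.le _ t) le_rfl) hY.continuous_paths
  exact ⟨V, hV, h⟩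

lemma measurable_comp_control (hφ : Continuous fun p : EuclideanSpace ℝ (Fin N) × D => φ p.1 p.2)
    (hδ : Measurable (Function.uncurry δ)) (hY : Measurable (Function.uncurry Y)) :
    Measurable (Function.uncurry fun (s : ℝ) ω => φ (Y s.toNNReal ω) (δ s.toNNReal ω)) := by
  have hr : Measurable fun p : ℝ × Ω => (p.1.toNNReal, p.2) :=
    (measurable_real_toNNReal.comp measurable_fst).prodMk measurable_snd
  exact hφ.measurable.comp ((hY.comp hr).prodMk (hδ.comp hr))

lemma measurable_discountedReward
    (hh : Continuous fun p : EuclideanSpace ℝ (Fin N) × D => h p.1 p.2)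
    (hφ : Continuous fun p : EuclideanSpace ℝ (Fin N) × D => φ p.1 p.2)
    (hδ : Measurable (Function.uncurry δ)) (hY : Measurable (Function.uncurry Y)) :
    Measurable fun p : Ω × ℝ => discountedReward h φ Y δ p.2 p.1 :=
  (measurable_primitive (measurable_comp_control hh hδ hY)).exp.mul
    ((measurable_comp_control hφ hδ hY).comp measurable_swap)

lemma IsStrongSolution.aestronglyMeasurable_prod_discountedReward [SFinite P]
    (hY : IsStrongSolution hW i δ y Y) (hδ : IsControl hW δ)
    (hh : Continuous fun p : EuclideanSpace ℝ (Fin N) × D => h p.1 p.2)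
    (hφ : Continuous fun p : EuclideanSpace ℝ (Fin N) × D => φ p.1 p.2)
    (ν : Measure ℝ) [SFinite ν] :
    AEStronglyMeasurable (fun p : Ω × ℝ => discountedReward h φ Y δ p.2 p.1) (P.prod ν) := by
  obtain ⟨V, hV, hYV⟩ := hY.exists_measurable_modification
  refine (measurable_discountedReward hh hφ hδ.measurable_uncurry
    hV).aestronglyMeasurable.congr ?_
  filter_upwards [Measure.quasiMeasurePreserving_fst.ae hYV] with p hp
  exact (discountedReward_congr hp _).symm

lemma IsStrongSolution.aestronglyMeasurable_discountedReward
    (hY : IsStrongSolution hW i δ y Y) (hδ : IsControl hW δ)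
    (hh : Continuous fun p : EuclideanSpace ℝ (Fin N) × D => h p.1 p.2)
    (hφ : Continuous fun p : EuclideanSpace ℝ (Fin N) × D => φ p.1 p.2) (s : ℝ) :
    AEStronglyMeasurable (fun ω => discountedReward h φ Y δ s ω) P := by
  obtain ⟨V, hV, hYV⟩ := hY.exists_measurable_modification
  have hm : Measurable fun ω => discountedReward h φ V δ s ω :=
    (measurable_discountedReward hh hφ hδ.measurable_uncurry hV).comp
      (measurable_id.prodMk measurable_const)
  refine hm.aestronglyMeasurable.congr ?_
  filter_upwards [hYV] with ω hω
  exact (discountedReward_congr hω _).symm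

/-- The state is bounded pathwise by the Wiener process, uniformly in the control. -/
lemma IsStrongSolution.ae_norm_le (hY : IsStrongSolution hW i δ y Y) (hC : 0 ≤ C) (hL : 0 ≤ L)
    (hi : ∀ x d, ‖i x d‖ ≤ C + L * ‖x‖) :
    ∀ᵐ ω ∂P, ∀ t : ℝ, 0 ≤ t →
      ‖Y t.toNNReal ω‖ ≤ ‖y‖ + C * t + ‖W t.toNNReal ω‖
          + L * ∫ r in (0 : ℝ)..t, ‖Y r.toNNReal ω‖ ∧
      ∫ r in (0 : ℝ)..t, ‖Y r.toNNReal ω‖ ≤ Real.exp (L * t) *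
        (‖y‖ * t + C * (t ^ 2 / 2) + ∫ r in (0 : ℝ)..t, ‖W r.toNNReal ω‖) := by
  filter_upwards [hY.continuous_paths, hY.equation, hW.ae_continuous] with ω hYc heq hWc
  have hu : Continuous fun r : ℝ => ‖Y r.toNNReal ω‖ := (hYc.comp continuous_real_toNNReal).norm
  have hw : Continuous fun r : ℝ => ‖W r.toNNReal ω‖ := (hWc.comp continuous_real_toNNReal).norm
  have h1 : ∀ t : ℝ, 0 ≤ t → ‖Y t.toNNReal ω‖ ≤ ‖y‖ + C * t + ‖W t.toNNReal ω‖
      + L * ∫ r in (0 : ℝ)..t, ‖Y r.toNNReal ω‖ := fun t ht => by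
    have e := heq t.toNNReal
    rw [Real.coe_toNNReal t ht] at e
    have hI : ‖∫ s in (0 : ℝ)..t, i (Y s.toNNReal ω) (δ s.toNNReal ω)‖
        ≤ ∫ s in (0 : ℝ)..t, (C + L * ‖Y s.toNNReal ω‖) :=
      intervalIntegral.norm_integral_le_of_norm_le ht (ae_of_all _ fun s _ => hi _ _)
        ((continuous_const.add (hu.const_mul L)).intervalIntegrable _ _)
    rw [intervalIntegral.integral_add intervalIntegrable_const
      ((hu.const_mul L).intervalIntegrable _ _), intervalIntegral.integral_const,
      intervalIntegral.integral_const_mul, sub_zero, smul_eq_mul] at hI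
    have := norm_add₃_le (a := y) (b := ∫ s in (0 : ℝ)..t, i (Y s.toNNReal ω) (δ s.toNNReal ω))
      (c := W t.toNNReal ω)
    rw [e]
    linarith
  intro t ht
  refine ⟨h1 t ht, ?_⟩
  have hw' : Continuous fun r : ℝ => ‖y‖ + C * r + ‖W r.toNNReal ω‖ := by fun_prop
  -- Grönwall bounds the time integral of the norm; the control has disappeared from the right-hand
  -- side.
  have h2 := integral_le_exp_mul_integral_of_le_add_mul_integral hL hu hw'
    (fun t ht => by positivity) h1 ht
  have e : ∫ r in (0 : ℝ)..t, (‖y‖ + C * r + ‖W r.toNNReal ω‖)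
      = ‖y‖ * t + C * (t ^ 2 / 2) + ∫ r in (0 : ℝ)..t, ‖W r.toNNReal ω‖ := by
    rw [intervalIntegral.integral_add (Continuous.intervalIntegrable (by fun_prop) _ _)
      (hw.intervalIntegrable _ _), intervalIntegral.integral_add intervalIntegrable_const
      (Continuous.intervalIntegrable (by fun_prop) _ _)]
    rw [intervalIntegral.integral_const, intervalIntegral.integral_const_mul, integral_id]
    simp [mul_comm t]
  rwa [e] at h2

/-- The discounted reward has an exponential envelope which does not depend on the control. -/
lemma exists_ae_abs_discountedReward_le (hW : IsWienerProcess W P) (y : EuclideanSpace ℝ (Fin N))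
    (hC : 0 ≤ C) (hL : 0 ≤ L) (hi : ∀ x d, ‖i x d‖ ≤ C + L * ‖x‖)
    (hh : ∀ x d, |h x d| ≤ C + L * ‖x‖) (hφ : ∀ x d, |φ x d| ≤ C + L * ‖x‖) {s : ℝ} (hs : 0 ≤ s) :
    ∃ a b c : ℝ, 0 ≤ b ∧ 0 ≤ c ∧ ∀ (δ : ℝ≥0 → Ω → D) (Y : ℝ≥0 → Ω → EuclideanSpace ℝ (Fin N)),
      IsStrongSolution hW i δ y Y → ∀ᵐ ω ∂P, |discountedReward h φ Y δ s ω|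
        ≤ Real.exp (a + b * (∫ r in (0 : ℝ)..s, ‖W r.toNNReal ω‖) + c * ‖W s.toNNReal ω‖) := by
  set m := ‖y‖ * s + C * (s ^ 2 / 2) with hm
  -- The exponent is at most `C s + L ∫ ‖Y‖ + C + L ‖Y_s‖`. Inserting the bound on `‖Y_s‖` gives `∫
  -- ‖Y‖` the factor `L + L²`, and Grönwall replaces `∫ ‖Y‖` by `exp (L s) (m + ∫ ‖W‖)`.
  refine ⟨C * s + C + L * (‖y‖ + C * s) + (L + L ^ 2) * Real.exp (L * s) * m,
    (L + L ^ 2) * Real.exp (L * s), L, by positivity, hL, fun δ Y hY => ?_⟩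
  filter_upwards [hY.ae_norm_le hC hL hi, hY.continuous_paths] with ω hω hYc
  have hu : Continuous fun r : ℝ => ‖Y r.toNNReal ω‖ := (hYc.comp continuous_real_toNNReal).norm
  obtain ⟨h1, h2⟩ := hω s hs
  have hI : ‖∫ r in (0 : ℝ)..s, h (Y r.toNNReal ω) (δ r.toNNReal ω)‖
      ≤ ∫ r in (0 : ℝ)..s, (C + L * ‖Y r.toNNReal ω‖) :=
    intervalIntegral.norm_integral_le_of_norm_le hs (ae_of_all _ fun s _ => hh _ _)
      ((continuous_const.add (hu.const_mul L)).intervalIntegrable _ _)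
  rw [intervalIntegral.integral_add intervalIntegrable_const
    ((hu.const_mul L).intervalIntegrable _ _), intervalIntegral.integral_const,
    intervalIntegral.integral_const_mul, sub_zero, smul_eq_mul] at hI
  have h3 := (le_abs_self _).trans hI
  have h4 := hφ (Y s.toNNReal ω) (δ s.toNNReal ω)
  have h5 : |φ (Y s.toNNReal ω) (δ s.toNNReal ω)| ≤ Real.exp (C + L * ‖Y s.toNNReal ω‖) :=
    h4.trans ((le_add_of_nonneg_right zero_le_one).trans (Real.add_one_le_exp _))
  have h6 := mul_le_mul_of_nonneg_left h1 hL
  have h7 := mul_le_mul_of_nonneg_left h2 (by positivity : 0 ≤ L + L ^ 2)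
  rw [discountedReward, discountFactor, abs_mul, Real.abs_exp]
  refine (mul_le_mul_of_nonneg_left h5 (Real.exp_pos _).le).trans ?_
  rw [← Real.exp_add, Real.exp_le_exp, hm]
  linarith

end Solution

/-! ### Convergence of the reward at a fixed time -/

/-- Almost sure convergence of controls and states at each time implies almost sure convergence of
the discounted rewards at each time. -/
lemma ae_tendsto_discountedReward {Ω : Type*} [MeasurableSpace Ω] {P : Measure Ω} [SFinite P]
    {N k : ℕ} {W : ℝ≥0 → Ω → EuclideanSpace ℝ (Fin N)} {hW : IsWienerProcess W P}
    {D : Set (EuclideanSpace ℝ (Fin k))} {h φ : EuclideanSpace ℝ (Fin N) → D → ℝ}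
    {i : EuclideanSpace ℝ (Fin N) → D → EuclideanSpace ℝ (Fin N)}
    {y : EuclideanSpace ℝ (Fin N)} {C L : ℝ} (hC : 0 ≤ C) (hL : 0 ≤ L)
    (hi : ∀ x d, ‖i x d‖ ≤ C + L * ‖x‖) (hhC : ∀ x d, |h x d| ≤ C + L * ‖x‖)
    (hh : Continuous fun p : EuclideanSpace ℝ (Fin N) × D => h p.1 p.2)
    (hφ : Continuous fun p : EuclideanSpace ℝ (Fin N) × D => φ p.1 p.2)
    {δn : ℕ → ℝ≥0 → Ω → D} {δ : ℝ≥0 → Ω → D}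
    (hδn : ∀ n, IsControl hW (δn n)) (hδ : IsControl hW δ)
    {Yn : ℕ → ℝ≥0 → Ω → EuclideanSpace ℝ (Fin N)} {Y : ℝ≥0 → Ω → EuclideanSpace ℝ (Fin N)}
    (hYn : ∀ n, IsStrongSolution hW i (δn n) y (Yn n)) (hY : IsStrongSolution hW i δ y Y)
    (hδlim : ∀ t : ℝ≥0, ∀ᵐ ω ∂P, Tendsto (fun n => δn n t ω) atTop (𝓝 (δ t ω)))
    (hYlim : ∀ t : ℝ≥0, ∀ᵐ ω ∂P, Tendsto (fun n => Yn n t ω) atTop (𝓝 (Y t ω)))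
    {s : ℝ} (hs : 0 ≤ s) :
    ∀ᵐ ω ∂P, Tendsto (fun n => discountedReward h φ (Yn n) (δn n) s ω) atTop
      (𝓝 (discountedReward h φ Y δ s ω)) := by
  have hlim : ∀ (ψ : EuclideanSpace ℝ (Fin N) → D → ℝ),
      (Continuous fun p : EuclideanSpace ℝ (Fin N) × D => ψ p.1 p.2) → ∀ t : ℝ≥0, ∀ᵐ ω ∂P,
      Tendsto (fun n => ψ (Yn n t ω) (δn n t ω)) atTop (𝓝 (ψ (Y t ω) (δ t ω))) := by
    intro ψ hψ t
    filter_upwards [hδlim t, hYlim t] with ω h1 h2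
    exact (hψ.tendsto (Y t ω, δ t ω)).comp (h2.prodMk_nhds h1)
  choose Vn hVn hYVn using fun n => (hYn n).exists_measurable_modification
  obtain ⟨V, hV, hYV⟩ := hY.exists_measurable_modification
  have hYVn' := ae_all_iff.2 hYVn
  -- The null set in the hypotheses depends on the time. Fubini exchanges the quantifiers, which
  -- requires jointly measurable versions of the states; subtracting the limit makes the target the
  -- constant `0`, so the convergence set is measurable.
  have hae : ∀ᵐ ω ∂P, ∀ᵐ r : ℝ, Tendsto
      (fun n => h (Yn n r.toNNReal ω) (δn n r.toNNReal ω)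
        - h (Y r.toNNReal ω) (δ r.toNNReal ω)) atTop (𝓝 0) := by
    have hmeas : MeasurableSet {p : Ω × ℝ | Tendsto
        (fun n => h (Vn n p.2.toNNReal p.1) (δn n p.2.toNNReal p.1)
          - h (V p.2.toNNReal p.1) (δ p.2.toNNReal p.1)) atTop (𝓝 0)} :=
      measurableSet_tendsto (𝓝 0) fun n =>
        ((measurable_comp_control hh (hδn n).measurable_uncurry (hVn n)).comp measurable_swap).sub
          ((measurable_comp_control hh hδ.measurable_uncurry hV).comp measurable_swap)
    have hV' : ∀ᵐ ω ∂P, ∀ᵐ r : ℝ, Tendsto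
        (fun n => h (Vn n r.toNNReal ω) (δn n r.toNNReal ω)
          - h (V r.toNNReal ω) (δ r.toNNReal ω)) atTop (𝓝 0) := by
      rw [Measure.ae_ae_comm hmeas]
      refine ae_of_all _ fun r => ?_
      filter_upwards [hlim h hh r.toNNReal, hYVn', hYV] with ω h1 h2 h3
      simp only [← h2, ← h3]
      exact tendsto_sub_nhds_zero_iff.2 h1
    filter_upwards [hV', hYVn', hYV] with ω h1 h2 h3
    simpa only [h2, h3] using h1
  have hbound := ae_all_iff.2 fun n => (hYn n).ae_norm_le hC hL hi
  filter_upwards [hae, hlim φ hφ s.toNNReal, hbound, hW.ae_continuous, hYVn'] with ω h1 h2 h3 hWc h4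
  have hw : Continuous fun r : ℝ => ‖W r.toNNReal ω‖ := (hWc.comp continuous_real_toNNReal).norm
  have hp : Continuous fun t : ℝ => ∫ r in (0 : ℝ)..t, ‖W r.toNNReal ω‖ :=
    intervalIntegral.continuous_primitive (fun a b => hw.intervalIntegrable a b) 0
  have hint : Tendsto (fun n => ∫ r in (0 : ℝ)..s, h (Yn n r.toNNReal ω) (δn n r.toNNReal ω)) atTop
      (𝓝 (∫ r in (0 : ℝ)..s, h (Y r.toNNReal ω) (δ r.toNNReal ω))) := by
    -- The dominating function is the pathwise Grönwall bound inserted in the growth bound for `h`;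
    -- it is continuous in `r` and independent of `n`.
    refine intervalIntegral.tendsto_integral_filter_of_dominated_convergence
      (fun r => C + L * (‖y‖ + C * r + ‖W r.toNNReal ω‖ + L * (Real.exp (L * r) *
        (‖y‖ * r + C * (r ^ 2 / 2) + ∫ q in (0 : ℝ)..r, ‖W q.toNNReal ω‖))))
      (Eventually.of_forall fun n => ?_) (Eventually.of_forall fun n => ae_of_all _ fun r hr => ?_)
      (Continuous.intervalIntegrable (by fun_prop) _ _) ?_
    · have hm : Measurable fun r : ℝ => h (Vn n r.toNNReal ω) (δn n r.toNNReal ω) :=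
        (measurable_comp_control hh (hδn n).measurable_uncurry (hVn n)).comp
          (measurable_id.prodMk measurable_const)
      simp only [h4]
      exact hm.aestronglyMeasurable
    · rw [Set.uIoc_of_le hs] at hr
      obtain ⟨e1, e2⟩ := h3 n r hr.1.le
      refine (hhC _ _).trans ?_
      gcongr
      exact e1.trans (by gcongr)
    · filter_upwards [h1] with r hr _
      exact tendsto_sub_nhds_zero_iff.1 hr
  exact ((Real.continuous_exp.tendsto _).comp hint).mul h2

end DiscountedControl

/-! ### Assembly of the limits -/

theorem mainTheorem7 {Ω : Type*} [MeasurableSpace Ω] (P : Measure Ω) [IsProbabilityMeasure P]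
    {N k : ℕ} (W : ℝ≥0 → Ω → EuclideanSpace ℝ (Fin N))
    (hW : DiscountedControl.IsWienerProcess W P)
    (D : Set (EuclideanSpace ℝ (Fin k))) (hD : IsCompact D)
    (f h : EuclideanSpace ℝ (Fin N) → D → ℝ) (g : EuclideanSpace ℝ (Fin N) → ℝ)
    (i : EuclideanSpace ℝ (Fin N) → D → EuclideanSpace ℝ (Fin N)) (L₁ L₂ : ℝ)
    (hcoef : DiscountedControl.CoefficientAssumption f h g i L₁ L₂)
    (hinf : DiscountedControl.InfiniteHorizonAssumption hW f h i L₂)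
    (y : EuclideanSpace ℝ (Fin N))
    (T : ℕ → ℝ) (hT : Tendsto T atTop atTop)
    (δn : ℕ → ℝ≥0 → Ω → D) (δ : ℝ≥0 → Ω → D)
    (hδn : ∀ n, DiscountedControl.IsControl hW (δn n))
    (hδ : DiscountedControl.IsControl hW δ)
    (Yn : ℕ → ℝ≥0 → Ω → EuclideanSpace ℝ (Fin N)) (Y : ℝ≥0 → Ω → EuclideanSpace ℝ (Fin N))
    (hYn : ∀ n, DiscountedControl.IsStrongSolution hW i (δn n) y (Yn n))
    (hY : DiscountedControl.IsStrongSolution hW i δ y Y)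
    (hδlim : ∀ t : ℝ≥0, ∀ᵐ ω ∂P, Tendsto (fun n => δn n t ω) atTop (𝓝 (δ t ω)))
    (hYlim : ∀ t : ℝ≥0, ∀ᵐ ω ∂P, Tendsto (fun n => Yn n t ω) atTop (𝓝 (Y t ω))) :
    (∀ n, Integrable
        (fun p : Ω × ℝ => DiscountedControl.discountedReward h f (Yn n) (δn n) p.2 p.1)
        (P.prod (volume.restrict (Set.Icc 0 (T n))))) ∧
    Integrable (fun p : Ω × ℝ => DiscountedControl.discountedReward h f Y δ p.2 p.1)
        (P.prod (volume.restrict (Set.Ici 0))) ∧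
    Tendsto (fun n => DiscountedControl.expectedReward P h (fun x d => |f x d|)
        (Yn n) (δn n) (Set.Icc 0 (T n))) atTop
      (𝓝 (DiscountedControl.expectedReward P h (fun x d => |f x d|) Y δ (Set.Ici 0))) ∧
    Tendsto (fun n => DiscountedControl.expectedReward P h f
        (Yn n) (δn n) (Set.Icc 0 (T n))) atTop
      (𝓝 (DiscountedControl.expectedReward P h f Y δ (Set.Ici 0))) := by
  -- The discount factor is positive, so the reward for `|f|` is the absolute value of the reward
  -- for `f`; one set of bounds serves both limits.
  have habs : ∀ (Z : ℝ≥0 → Ω → EuclideanSpace ℝ (Fin N)) (η : ℝ≥0 → Ω → D) s ω,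
      DiscountedControl.discountedReward h (fun x d => |f x d|) Z η s ω
        = |DiscountedControl.discountedReward h f Z η s ω| := fun Z η s ω => by
    rw [DiscountedControl.discountedReward, DiscountedControl.discountedReward, abs_mul,
      DiscountedControl.discountFactor, Real.abs_exp]
  obtain ⟨Cf, hCf⟩ := DiscountedControl.exists_linear_growth hD hcoef.continuous_f
    hcoef.lipschitz_f
  obtain ⟨Ch, hCh⟩ := DiscountedControl.exists_linear_growth hD hcoef.continuous_h
    hcoef.lipschitz_h
  obtain ⟨Ci, hCi⟩ := DiscountedControl.exists_linear_growth hD hcoef.continuous_i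
    hcoef.lipschitz_i
  set C := max 0 (max Cf (max Ch Ci)) with hCdef
  have hC : 0 ≤ C := le_max_left _ _
  have hf' : ∀ x d, |f x d| ≤ C + L₁ * ‖x‖ := fun x d => (hCf x d).trans (by gcongr; simp [hCdef])
  have hh' : ∀ x d, |h x d| ≤ C + L₁ * ‖x‖ := fun x d => (hCh x d).trans (by gcongr; simp [hCdef])
  have hi' : ∀ x d, ‖i x d‖ ≤ C + L₁ * ‖x‖ := fun x d => (hCi x d).trans (by gcongr; simp [hCdef])
  have hL := hcoef.L₁_pos.le
  obtain ⟨κ, -, hκ, hκint, -⟩ := hinf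
  obtain ⟨m, hm⟩ := exists_nat_ge ‖y‖
  have hle : ∀ (η : ℝ≥0 → Ω → D) (Z : ℝ≥0 → Ω → EuclideanSpace ℝ (Fin N)),
      DiscountedControl.IsControl hW η → DiscountedControl.IsStrongSolution hW i η y Z →
      ∀ t : ℝ, 0 < t → ∫⁻ ω, ENNReal.ofReal |DiscountedControl.discountedReward h f Z η t ω| ∂P
        ≤ ENNReal.ofReal (κ t m) := fun η Z hη hZ t ht => by
    have := hκ η hη m y hm Z hZ t.toNNReal (Real.toNNReal_pos.2 ht)
    rw [Real.coe_toNNReal t ht.le] at this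
    refine (lintegral_mono fun ω => ENNReal.ofReal_le_ofReal ?_).trans this
    rw [← habs]
    exact mul_le_mul_of_nonneg_left (le_max_left _ _) (Real.exp_pos _).le
  have hint : ∀ (η : ℝ≥0 → Ω → D) (Z : ℝ≥0 → Ω → EuclideanSpace ℝ (Fin N)),
      DiscountedControl.IsControl hW η → DiscountedControl.IsStrongSolution hW i η y Z →
      Integrable (fun p : Ω × ℝ => DiscountedControl.discountedReward h f Z η p.2 p.1)
        (P.prod (volume.restrict (Set.Ici 0))) := fun η Z hη hZ =>
    DiscountedControl.integrable_prod_of_lintegral_le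
      (hZ.aestronglyMeasurable_prod_discountedReward hη hcoef.continuous_h hcoef.continuous_f _)
      (hκint m) (hle η Z hη hZ)
  have hae : ∀ t : ℝ, 0 < t → ∀ᵐ ω ∂P, Tendsto
      (fun n => DiscountedControl.discountedReward h f (Yn n) (δn n) t ω) atTop
      (𝓝 (DiscountedControl.discountedReward h f Y δ t ω)) := fun t ht =>
    DiscountedControl.ae_tendsto_discountedReward hC hL hi' hh' hcoef.continuous_h
      hcoef.continuous_f hδn hδ hYn hY hδlim hYlim ht.le
  -- At each fixed time, the integrable majorant in `ω` is the Wiener envelope, common to all `n`.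
  have hdom : ∀ t : ℝ, 0 < t → ∃ Z : Ω → ℝ, Integrable Z P ∧ ∀ n, ∀ᵐ ω ∂P,
      |DiscountedControl.discountedReward h f (Yn n) (δn n) t ω| ≤ Z ω := fun t ht => by
    obtain ⟨a, b, c, hb, hc, hle⟩ :=
      DiscountedControl.exists_ae_abs_discountedReward_le hW y hC hL hi' hh' hf' ht.le
    exact ⟨_, hW.integrable_exp_envelope hb hc ht, fun n => hle _ _ (hYn n)⟩
  have hmeas : ∀ n t, AEStronglyMeasurable
      (fun ω => DiscountedControl.discountedReward h f (Yn n) (δn n) t ω) P := fun n t =>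
    (hYn n).aestronglyMeasurable_discountedReward (hδn n) hcoef.continuous_h hcoef.continuous_f t
  refine ⟨fun n => ?_, hint δ Y hδ hY, ?_, ?_⟩
  · exact (hint _ _ (hδn n) (hYn n)).mono_measure
      (Measure.prod_mono le_rfl (Measure.restrict_mono Set.Icc_subset_Ici_self le_rfl))
  · simp only [DiscountedControl.expectedReward, habs]
    refine DiscountedControl.tendsto_integral_setIntegral_of_lintegral_le hT
      (fun n => (hint _ _ (hδn n) (hYn n)).abs) (hint δ Y hδ hY).abs (hκint m)
      (fun n t ht => ?_) fun t ht => ?_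
    · simpa only [abs_abs] using hle _ _ (hδn n) (hYn n) t ht
    · obtain ⟨Z, hZ, hZle⟩ := hdom t ht
      refine tendsto_integral_of_dominated_convergence Z (fun n => (hmeas n t).norm) hZ
        (fun n => ?_) ?_
      · simpa only [Real.norm_eq_abs, abs_abs] using hZle n
      · filter_upwards [hae t ht] with ω hω using hω.abs
  · refine DiscountedControl.tendsto_integral_setIntegral_of_lintegral_le hT
      (fun n => hint _ _ (hδn n) (hYn n)) (hint δ Y hδ hY) (hκint m)
      (fun n t ht => hle _ _ (hδn n) (hYn n) t ht) fun t ht => ?_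
    obtain ⟨Z, hZ, hZle⟩ := hdom t ht
    exact tendsto_integral_of_dominated_convergence Z (fun n => hmeas n t) hZ hZle (hae t ht)
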